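/- All graphs are finite and simple, and a graph is regarded as a one-dimensional cell complex. (For two particles a graph is sufficiently subdivided exactly when it has no loops and no multiple edges.) For a graph $\Gamma$, let $\overline D_2(\Gamma)$ be the discrete configuration space of two distinguishable particles on $\Gamma$: the subcomplex of the cubical complex $\Gamma\times\Gamma$ whose cells are the products $\sigma_1\times\sigma_2$ of cells (vertices or closed edges) $\sigma_1,\sigma_2$ of $\Gamma$ with $\sigma_1\cap\sigma_2=\emptyset$. Let $\beta_k$ denote the $k$-th Betti number, i.e. the rank of the $k$-th cellular homology group with integer coefficients. Let $\Gamma$ be a one-connected graph, i.e. $\Gamma$ is connected and there is a vertex $v$ such that $\Gamma$ becomes disconnected after removing $v$ together with the edges at $v$. Suppose that $\Gamma$ is the wedge sum at $v$ of subgraphs $\Gamma_1,\dots,\Gamma_m$ (its components): their union is $\Gamma$, each of them contains $v$, and any two of them have only the vertex $v$ in common. Let $\tilde\Gamma_i$ be the graph obtained from $\Gamma_i$ by subdividing once each edge at $v$ and removing $v$ together with the segments at $v$ of the subdivided edges. (i) If $m=2$, then \[\beta_2(\overline D_2(\Gamma))=\beta_2(\overline D_2(\Gamma_1))+\beta_2(\overline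 D_2(\Gamma_2))+2\left(\beta_1(\tilde\Gamma_1)\beta_1(\Gamma_2)+\beta_1(\Gamma_1)\beta_1(\tilde\Gamma_2)-\beta_1(\tilde\Gamma_1)\beta_1(\tilde\Gamma_2)\right).\] (ii) For every number $m$ of components, with $\mu_i:=\beta_1(\Gamma_i)-\beta_1(\tilde\Gamma_i)$, \[\beta_2(\overline D_2(\Gamma))=\sum_i\beta_2(\overline D_2(\Gamma_i))+2\sum_{i<j}\left(\beta_1(\Gamma_i)\beta_1(\Gamma_j)-\mu_i\mu_j\right).\] -/

import Mathlib

namespace GraphConf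

/-- Formal cells of a graph with vertices in `V`, regarded as a one-dimensional cell complex:
a vertex, or an edge `edge a b` with terminal vertex `a` and initial vertex `b`. Which formal
cells are present in a given graph is decided by `IsCell` below. -/
inductive Cell (V : Type*) where
  | vertex : V → Cell V
  | edge : V → V → Cell V

/-- The dimension of a cell: `0` for a vertex and `1` for an edge. -/
def Cell.dim {V : Type*} : Cell V → ℕ
  | .vertex _ => 0
  | .edge _ _ => 1

/-- The vertices contained in the closed cell. In a simple graph two closed cells are disjoint
if and only if these vertex sets are disjoint. -/
def Cell.ends {V : Type*} : Cell V → Set V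
  | .vertex v => {v}
  | .edge a b => {a, b}

/-- The cellular boundary: the initial vertex of an edge minus its terminal vertex. -/
noncomputable def Cell.boundary {V : Type*} : Cell V → (Cell V →₀ ℤ)
  | .vertex _ => 0
  | .edge a b => Finsupp.single (.vertex b) 1 - Finsupp.single (.vertex a) 1

/-- The dimension of a product cell. -/
def pairDim {V : Type*} (p : Cell V × Cell V) : ℕ := p.1.dim + p.2.dim

/-- The cellular boundary of a product cell,
`∂ (s × t) = ∂ s × t + (-1) ^ (dim s) * (s × ∂ t)`. -/
noncomputable def pairBoundary {V : Type*} (p : Cell V × Cell V) :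
    (Cell V × Cell V →₀ ℤ) :=
  (p.1.boundary).mapDomain (fun s => (s, p.2)) +
    (-1 : ℤ) ^ p.1.dim • (p.2.boundary).mapDomain (fun t => (p.1, t))

/-- The group of integral `k`-chains of the complex whose set of cells is `X`. -/
def chains {S : Type*} (dim : S → ℕ) (X : Set S) (k : ℕ) : Submodule ℤ (S →₀ ℤ) :=
  Finsupp.supported ℤ ℤ {s | s ∈ X ∧ dim s = k}

/-- The group of `k`-cycles. -/
noncomputable def cycles {S : Type*} (dim : S → ℕ) (bd : S → (S →₀ ℤ)) (X : Set S) (k : ℕ) :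
    Submodule ℤ (S →₀ ℤ) :=
  chains dim X k ⊓ LinearMap.ker (Finsupp.linearCombination ℤ bd)

/-- The group of `k`-boundaries, i.e. the boundaries of the `(k + 1)`-chains. -/
noncomputable def boundaries {S : Type*} (dim : S → ℕ) (bd : S → (S →₀ ℤ)) (X : Set S)
    (k : ℕ) : Submodule ℤ (S →₀ ℤ) :=
  (chains dim X (k + 1)).map (Finsupp.linearCombination ℤ bd)

/-- The `k`-th Betti number: the rank of the abelian group of `k`-cycles modulo
`k`-boundaries. -/
noncomputable def betti {S : Type*} (dim : S → ℕ) (bd : S → (S →₀ ℤ)) (X : Set S)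
    (k : ℕ) : ℕ :=
  Module.finrank ℤ (cycles dim bd X k ⧸ (boundaries dim bd X k).submoduleOf (cycles dim bd X k))

/-- The cells of a graph `H` (a subgraph of some simple graph). Vertices are numbered by the
linear order, and an edge runs between its terminal vertex `a` and its initial vertex `b`,
where `a < b`. -/
def IsCell {V : Type*} [LinearOrder V] {G : SimpleGraph V} (H : G.Subgraph) : Cell V → Prop
  | .vertex v => v ∈ H.verts
  | .edge a b => a < b ∧ H.Adj a b

/-- The set of cells of a graph. -/
def graphCells {V : Type*} [LinearOrder V] {G : SimpleGraph V} (H : G.Subgraph) :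
    Set (Cell V) := {c | IsCell H c}

/-- The cells of the discrete configuration space of two distinguishable particles on `H`:
ordered pairs of cells of `H` whose closures are disjoint. -/
def confCells {V : Type*} [LinearOrder V] {G : SimpleGraph V} (H : G.Subgraph) :
    Set (Cell V × Cell V) :=
  {p | IsCell H p.1 ∧ IsCell H p.2 ∧ Disjoint p.1.ends p.2.ends}

/-- The `k`-th Betti number of the graph `H`. -/
noncomputable def graphBetti {V : Type*} [LinearOrder V] {G : SimpleGraph V} (H : G.Subgraph)
    (k : ℕ) : ℕ := betti Cell.dim Cell.boundary (graphCells H) k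

/-- The `k`-th Betti number of the two-particle discrete configuration space of `H`, for
distinguishable particles. -/
noncomputable def confBetti {V : Type*} [LinearOrder V] {G : SimpleGraph V} (H : G.Subgraph)
    (k : ℕ) : ℕ := betti pairDim pairBoundary (confCells H) k

/-- `G` is one-connected, with cut vertex `v`: it is connected and becomes disconnected after
the removal of `v` and of the edges at `v`. -/
def IsOneConnectedAt {V : Type*} (G : SimpleGraph V) (v : V) : Prop :=
  G.Connected ∧ ¬ (G.induce {v}ᶜ).Preconnected

/-- `G` is the wedge sum at `v` of its subgraphs `H i`, the components of `G`: their union is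
`G`, they all contain `v`, and any two of them have only `v` in common. -/
structure IsWedge {V ι : Type*} (G : SimpleGraph V) (v : V) (H : ι → G.Subgraph) : Prop where
  iSup_eq : ⨆ i, H i = ⊤
  base_mem : ∀ i, v ∈ (H i).verts
  inter_eq : ∀ i j, i ≠ j → (H i).verts ∩ (H j).verts = {v}

/-- The simple graph obtained from `G` by subdividing once every edge at `v`. The old vertex `w`
is `Sum.inlₗ w`, and the new vertex on the edge from `u` to `v` is `Sum.inrₗ u`. (For `u` not
adjacent to `v` the point `Sum.inrₗ u` is isolated; it is not used.) -/
def subdivideAt {V : Type*} (G : SimpleGraph V) (v : V) : SimpleGraph (V ⊕ₗ V) where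
  Adj x y := match ofLex x, ofLex y with
    | .inl a, .inl b => G.Adj a b ∧ a ≠ v ∧ b ≠ v
    | .inl a, .inr u => G.Adj u v ∧ (a = u ∨ a = v)
    | .inr u, .inl a => G.Adj u v ∧ (a = u ∨ a = v)
    | .inr _, .inr _ => False
  symm := by
    refine ⟨fun x y h => ?_⟩
    rcases hx : ofLex x with a | a <;> rcases hy : ofLex y with b | b <;>
      simp_all [SimpleGraph.adj_comm]
  loopless := by
    refine ⟨fun x h => ?_⟩
    rcases hx : ofLex x with a | a <;> simp_all

/-- The graph `H` detached from `v`: every edge of `H` at `v` is subdivided once, and the vertex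
`v` is removed together with the segment at `v` of each subdivided edge. -/
def detach {V : Type*} {G : SimpleGraph V} (v : V) (H : G.Subgraph) :
    (subdivideAt G v).Subgraph where
  verts := {x | match ofLex x with
    | .inl a => a ∈ H.verts ∧ a ≠ v
    | .inr u => H.Adj u v}
  Adj x y := match ofLex x, ofLex y with
    | .inl a, .inl b => H.Adj a b ∧ a ≠ v ∧ b ≠ v
    | .inl a, .inr u => H.Adj u v ∧ a = u
    | .inr u, .inl a => H.Adj u v ∧ a = u
    | .inr _, .inr _ => False
  adj_sub {x y} h := by
    rcases hx : ofLex x with a | a <;> rcases hy : ofLex y with b | b <;>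
      simp only [subdivideAt, hx, hy] at h ⊢
    · exact ⟨h.1.adj_sub, h.2⟩
    · exact ⟨h.1.adj_sub, Or.inl h.2⟩
    · exact ⟨h.1.adj_sub, Or.inl h.2⟩
  edge_vert {x y} h := by
    rcases hx : ofLex x with a | a <;> rcases hy : ofLex y with b | b <;>
      simp only [hx, hy, Set.mem_ofPred_eq] at h ⊢
    · exact ⟨h.1.fst_mem, h.2.1⟩
    · exact ⟨h.2 ▸ h.1.fst_mem, h.2 ▸ h.1.adj_sub.ne⟩
    · exact h.1
  symm := by
    refine ⟨fun x y h => ?_⟩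
    rcases hx : ofLex x with a | a <;> rcases hy : ofLex y with b | b <;>
      simp_all [SimpleGraph.Subgraph.adj_comm]

/-- The number of independent cycles of `H` that are lost after detaching `v`. -/
noncomputable def lostCycles {V : Type*} [LinearOrder V] {G : SimpleGraph V} (v : V)
    (H : G.Subgraph) : ℤ := (graphBetti H 1 : ℤ) - graphBetti (detach v H) 1

end GraphConf

/-! The complex has no 3-cells, so its second Betti number is the rank of the group of 2-cycles. A
2-chain is an integer matrix indexed by ordered pairs of disjoint edges, and it is a 2-cycle exactly
when each row and each column is a 1-cycle of the graph (`confBetti_two`). Restricting a 1-cycle of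
a wedge to one component gives a 1-cycle, so these matrices split into blocks indexed by pairs of
components (`finrank_biclosedOn_eq_sum`). The diagonal block of `Γ_i` gives the 2-cycles of its own
configuration space. For `i ≠ j`, two edges fail to be disjoint only if both are at `v`, so the
block consists of the matrices with cyclic rows and columns that vanish on (edges at `v`) × (edges
at `v`). Without the vanishing condition the rank would be `β₁(Γ_i) β₁(Γ_j)`. A basis of the cycles
of `Γ_j` adapted to those avoiding `v` shows that the condition costs exactly `μ_i μ_j`
(`finrank_biclosedOn_prod_diff`), because cycles avoiding `v` are counted by the detached graph
(`graphBetti_detach_one`). -/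

namespace GraphConf

open Module

/-! ### Integer linear algebra of matrices with cyclic rows and columns -/

/-- A basis of a module adapted to a submodule with torsion-free quotient. -/
theorem exists_adapted_basis {N : Type*} [AddCommGroup N] [Module.Free ℤ N] [Module.Finite ℤ N]
    (K : Submodule ℤ N) (hK : ∀ (n : ℤ) (x : N), n ≠ 0 → n • x ∈ K → x ∈ K) :
    ∃ (q : ℕ) (B : Basis (Fin (finrank ℤ K) ⊕ Fin q) ℤ N),
      ∀ x, x ∈ K ↔ ∀ j, B.repr x (.inr j) = 0 := by
  have htf : IsTorsionFree ℤ (N ⧸ K) := by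
    rw [Module.isTorsionFree_iff_smul_eq_zero]
    intro n x h
    obtain ⟨x, rfl⟩ := K.mkQ_surjective x
    by_cases hn : n = 0
    · exact .inl hn
    · right
      rw [← map_smul] at h
      simp only [Submodule.mkQ_apply, Submodule.Quotient.mk_eq_zero] at h ⊢
      exact hK n x hn h
  -- The quotient is finitely generated and torsion-free, hence free, so the projection splits and
  -- `N` is `K ⊕ N ⧸ K`.
  obtain ⟨s, hs⟩ := Module.projective_lifting_property K.mkQ LinearMap.id K.mkQ_surjective
  have hs' : ∀ y, K.mkQ (s y) = y := fun y => LinearMap.congr_fun hs y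
  have hker : ∀ x, x ∈ K ↔ K.mkQ x = 0 := fun x => (Submodule.Quotient.mk_eq_zero K).symm
  let e : (K × (N ⧸ K)) ≃ₗ[ℤ] N := LinearEquiv.ofBijective (K.subtype.coprod s) <| by
    constructor
    · rw [← LinearMap.ker_eq_bot, LinearMap.ker_eq_bot']
      rintro ⟨a, b⟩ h
      simp only [LinearMap.coprod_apply, Submodule.subtype_apply] at h
      have h2 : b = 0 := by
        have := congrArg K.mkQ h
        rwa [map_add, hs' b, map_zero, (hker _).1 a.2, zero_add] at this
      subst h2
      simpa using h
    · intro x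
      refine ⟨(⟨x - s (K.mkQ x), ?_⟩, K.mkQ x), by simp⟩
      rw [hker, map_sub, hs', sub_self]
  let B := ((finBasis ℤ K).prod (finBasis ℤ (N ⧸ K))).map e
  refine ⟨_, B, fun x => ?_⟩
  obtain ⟨⟨a, b⟩, rfl⟩ := e.surjective x
  have h1 : e (a, b) ∈ K ↔ b = 0 := by
    rw [hker]
    have : K.mkQ (e (a, b)) = b := by
      have he : e (a, b) = a + s b := rfl
      rw [he, map_add, hs' b, (hker _).1 a.2, zero_add]
    rw [this]
  rw [h1]
  simp only [B, Basis.map_repr, LinearEquiv.trans_apply, LinearEquiv.symm_apply_apply,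
    Basis.prod_repr_inr]
  rw [← (finBasis ℤ (N ⧸ K)).repr.map_eq_zero_iff, Finsupp.ext_iff]
  rfl

/-- The integral cycles supported on a set of edges, for an incidence matrix `d`. -/
def closedOn {E T : Type*} [Fintype E] (d : E → T → ℤ) (X : Set E) : Submodule ℤ (E → ℤ) where
  carrier := {z | (∀ e, e ∉ X → z e = 0) ∧ ∀ t, ∑ e, z e * d e t = 0}
  zero_mem' := by simp
  add_mem' := by
    rintro a b ⟨ha, ha'⟩ ⟨hb, hb'⟩
    refine ⟨fun e he => by simp [ha e he, hb e he], fun t => ?_⟩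
    simp [add_mul, Finset.sum_add_distrib, ha', hb']
  smul_mem' := by
    rintro c a ⟨ha, ha'⟩
    refine ⟨fun e he => by simp [ha e he], fun t => ?_⟩
    simp [mul_assoc, ← Finset.mul_sum, ha']

theorem mem_closedOn {E T : Type*} [Fintype E] {d : E → T → ℤ} {X : Set E} {z : E → ℤ} :
    z ∈ closedOn d X ↔ (∀ e, e ∉ X → z e = 0) ∧ ∀ t, ∑ e, z e * d e t = 0 := Iff.rfl

theorem closedOn_mono {E T : Type*} [Fintype E] {d : E → T → ℤ} {X Y : Set E} (h : X ⊆ Y) :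
    closedOn d X ≤ closedOn d Y := fun _ hz => ⟨fun e he => hz.1 e fun h' => he (h h'), hz.2⟩

/-- The matrices supported on a set of pairs of edges all of whose rows and columns are
cycles. -/
def biclosedOn {E T : Type*} [Fintype E] (d : E → T → ℤ) (P : Set (E × E)) :
    Submodule ℤ (E → E → ℤ) where
  carrier := {f | (∀ e e', (e, e') ∉ P → f e e' = 0) ∧
    (∀ e' t, ∑ e, f e e' * d e t = 0) ∧ ∀ e t, ∑ e', f e e' * d e' t = 0}
  zero_mem' := by simp
  add_mem' := by
    rintro a b ⟨ha, ha', ha''⟩ ⟨hb, hb', hb''⟩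
    refine ⟨fun e e' he => by simp [ha e e' he, hb e e' he], fun e' t => ?_, fun e t => ?_⟩ <;>
    simp [add_mul, Finset.sum_add_distrib, ha', hb', ha'', hb'']
  smul_mem' := by
    rintro c a ⟨ha, ha', ha''⟩
    refine ⟨fun e e' he => by simp [ha e e' he], fun e' t => ?_, fun e t => ?_⟩ <;>
    simp [mul_assoc, ← Finset.mul_sum, ha', ha'']

theorem mem_biclosedOn {E T : Type*} [Fintype E] {d : E → T → ℤ} {P : Set (E × E)}
    {f : E → E → ℤ} : f ∈ biclosedOn d P ↔ (∀ e e', (e, e') ∉ P → f e e' = 0) ∧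
    (∀ e' t, ∑ e, f e e' * d e t = 0) ∧ ∀ e t, ∑ e', f e e' * d e' t = 0 := Iff.rfl

/-- The rank of the group of matrices on `X × Y` that vanish on `S × T` and all of whose rows and
columns are cycles. -/
theorem finrank_biclosedOn_prod_diff {E T : Type*} [Fintype E] (d : E → T → ℤ)
    (X Y S S' : Set E) :
    (finrank ℤ (biclosedOn d ((X ×ˢ Y) \ (S ×ˢ S'))) : ℤ) =
      finrank ℤ (closedOn d X) * finrank ℤ (closedOn d Y) -
        ((finrank ℤ (closedOn d X) : ℤ) - finrank ℤ (closedOn d (X \ S))) *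
          ((finrank ℤ (closedOn d Y) : ℤ) - finrank ℤ (closedOn d (Y \ S'))) := by
  set N := closedOn d Y
  have hle : closedOn d (Y \ S') ≤ N := closedOn_mono Set.sdiff_subset
  set K := (closedOn d (Y \ S')).submoduleOf N
  have hmemK : ∀ z : N, z ∈ K ↔ ∀ e ∈ S', z.1 e = 0 := by
    intro z
    change z.1 ∈ closedOn d (Y \ S') ↔ _
    rw [mem_closedOn]
    refine ⟨fun h e he => h.1 e fun h' => h'.2 he, fun h => ⟨fun e he => ?_, z.2.2⟩⟩
    by_cases he' : e ∈ S'
    · exact h e he'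
    · exact z.2.1 e fun h' => he ⟨h', he'⟩
  have hKrank : finrank ℤ K = finrank ℤ (closedOn d (Y \ S')) :=
    (Submodule.submoduleOfEquivOfLe hle).finrank_eq
  obtain ⟨q, B, hB⟩ := exists_adapted_basis K <| by
    intro n x hn h
    rw [hmemK] at h ⊢
    intro e he
    simpa [hn] using h e he
  have hN : finrank ℤ N = finrank ℤ K + q := by
    rw [finrank_eq_card_basis B]; simp
  -- Expand every row in the adapted basis. The coefficients along a basis vector form a function on
  -- edges: any cycle on `X` is allowed along `K`, but only cycles avoiding `S` along the
  -- complement, since rows indexed by `S` lie in `K`.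
  let U : Fin (finrank ℤ K) ⊕ Fin q → Submodule ℤ (E → ℤ) :=
    Sum.elim (fun _ => closedOn d X) (fun _ => closedOn d (X \ S))
  have hU : ∀ i, U i ≤ closedOn d X := by
    rintro (i | i)
    · exact le_rfl
    · exact closedOn_mono Set.sdiff_subset
  set P := (X ×ˢ Y) \ (S ×ˢ S')
  have hrow : ∀ f ∈ biclosedOn d P, ∀ e, f e ∈ N := fun f hf e =>
    ⟨fun e' he' => hf.1 e e' fun h => he' h.1.2, hf.2.2 e⟩
  let row : biclosedOn d P →ₗ[ℤ] E → N := LinearMap.pi fun e =>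
    (LinearMap.proj e ∘ₗ (biclosedOn d P).subtype).codRestrict N fun f => hrow f f.2 e
  have hrow' : ∀ f e, (row f e).1 = f.1 e := fun f e => rfl
  let coef : ∀ i, biclosedOn d P →ₗ[ℤ] E → ℤ := fun i => LinearMap.pi fun e =>
    B.coord i ∘ₗ LinearMap.proj e ∘ₗ row
  have hcoef : ∀ i f e, coef i f e = B.repr (row f e) i := fun i f e => rfl
  have hmem : ∀ i f, coef i f ∈ U i := by
    intro i f
    have hX : coef i f ∈ closedOn d X := by
      refine ⟨fun e he => ?_, fun t => ?_⟩
      · have : row f e = 0 := Subtype.ext <| funext fun e' => f.2.1 e e' fun h => he h.1.1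
        rw [hcoef, this, map_zero, Finsupp.zero_apply]
      -- The column conditions together are one linear relation among the rows, so every coordinate
      -- inherits it.
      · have : ∑ e, d e t • row f e = 0 := by
          refine Subtype.ext <| funext fun e' => ?_
          have := f.2.2.1 e' t
          simpa [hrow', mul_comm] using this
        have := congrArg (fun x => B.repr x i) this
        simpa [hcoef, mul_comm] using this
    rcases i with i | i
    · exact hX
    · refine ⟨fun e he => ?_, hX.2⟩
      by_cases he' : e ∈ S
      · have : row f e ∈ K := by
          rw [hmemK]
          exact fun e' h => f.2.1 e e' fun h' => h'.2 ⟨he', h⟩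
        exact (hB _).1 this i
      · exact hX.1 e fun h => he ⟨h, he'⟩
  let Θ : biclosedOn d P →ₗ[ℤ] ∀ i, U i := LinearMap.pi fun i =>
    (coef i).codRestrict (U i) (hmem i)
  have hΘ : Function.Bijective Θ := by
    constructor
    · rw [← LinearMap.ker_eq_bot, LinearMap.ker_eq_bot']
      intro f hf
      refine Subtype.ext <| funext fun e => ?_
      have : row f e = 0 := by
        refine B.repr.injective <| Finsupp.ext fun i => ?_
        have h1 := congrFun (congrArg Subtype.val (congrFun hf i)) e
        change B.repr (row f e) i = 0 at h1
        simpa using h1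
      have := congrArg Subtype.val this
      exact this
    · intro g
      have hv : ∀ e, ((∑ i, (g i).1 e • B i : N) : E → ℤ) =
          fun e' => ∑ i, (g i).1 e * (B i).1 e' := by
        intro e; funext e'; simp
      have hf : (fun e e' => ∑ i, (g i).1 e * (B i).1 e') ∈ biclosedOn d P := by
        refine ⟨fun e e' h => Finset.sum_eq_zero fun i _ => ?_, fun e' t => ?_, fun e t => ?_⟩
        · by_cases he : e ∈ X
          swap
          · rw [(hU i (g i).2).1 e he, zero_mul]
          by_cases he' : e' ∈ Y
          swap
          · rw [(B i).2.1 e' he', mul_zero]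
          have hS : e ∈ S ∧ e' ∈ S' := by
            by_contra h'
            exact h ⟨⟨he, he'⟩, h'⟩
          rcases i with i | i
          · have : B (.inl i) ∈ K := by rw [hB]; simp
            rw [(hmemK _).1 this e' hS.2, mul_zero]
          · rw [(g (.inr i)).2.1 e fun h' => h'.2 hS.1, zero_mul]
        · simp_rw [Finset.sum_mul]
          rw [Finset.sum_comm]
          refine Finset.sum_eq_zero fun i _ => ?_
          have := (hU i (g i).2).2 t
          calc _ = (B i).1 e' * ∑ e, (g i).1 e * d e t := by
                rw [Finset.mul_sum]; exact Finset.sum_congr rfl fun _ _ => by ring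
            _ = 0 := by rw [this, mul_zero]
        · have := (∑ i, (g i).1 e • B i : N).2.2 t
          rw [hv] at this
          exact this
      refine ⟨⟨_, hf⟩, funext fun i => Subtype.ext <| funext fun e => ?_⟩
      change B.repr (row ⟨_, hf⟩ e) i = _
      have : row ⟨_, hf⟩ e = ∑ i, (g i).1 e • B i := Subtype.ext (hv e).symm
      rw [this, B.repr_sum_self]
  have hfin := (LinearEquiv.ofBijective Θ hΘ).finrank_eq
  have h1 : ∀ i, finrank ℤ (U (.inl i)) = finrank ℤ (closedOn d X) := fun _ => rfl
  have h2 : ∀ i, finrank ℤ (U (.inr i)) = finrank ℤ (closedOn d (X \ S)) := fun _ => rfl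
  rw [finrank_pi_fintype, Fintype.sum_sum_type, Finset.sum_congr rfl fun i _ => h1 i,
    Finset.sum_congr rfl fun i _ => h2 i, Finset.sum_const, Finset.sum_const, Finset.card_univ,
    Finset.card_univ, Fintype.card_fin, Fintype.card_fin, smul_eq_mul, smul_eq_mul] at hfin
  -- With `x`, `x'` the ranks for `X`, `X \ S` and `k` the rank of `K`, this is `k x + q x' = x (k +
  -- q) - (x - x') q`.
  rw [hfin, hN, ← hKrank]
  push_cast
  ring

/-- Matrices of cycles on a union of disjoint sets of edges decompose into blocks, provided that
the restriction of a cycle to each of the sets is a cycle. -/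
theorem finrank_biclosedOn_eq_sum {E T ι : Type*} [Fintype E] [Fintype ι] (d : E → T → ℤ)
    (X : ι → Set E) (hX : ∀ i j e, e ∈ X i → e ∈ X j → i = j) (P : Set (E × E))
    (hP : ∀ p ∈ P, (∃ i, p.1 ∈ X i) ∧ ∃ i, p.2 ∈ X i)
    (hres : ∀ i, ∀ z ∈ closedOn d (⋃ i, X i), (X i).indicator z ∈ closedOn d (X i)) :
    finrank ℤ (biclosedOn d P) =
      ∑ p : ι × ι, finrank ℤ (biclosedOn d (P ∩ X p.1 ×ˢ X p.2)) := by
  classical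
  have hcol : ∀ f ∈ biclosedOn d P, ∀ e', (fun e => f e e') ∈ closedOn d (⋃ i, X i) :=
    fun f hf e' => ⟨fun e he => hf.1 e e' fun h => he (Set.mem_iUnion.2 (hP _ h).1), hf.2.1 e'⟩
  have hrow : ∀ f ∈ biclosedOn d P, ∀ e, f e ∈ closedOn d (⋃ i, X i) :=
    fun f hf e => ⟨fun e' he => hf.1 e e' fun h => he (Set.mem_iUnion.2 (hP _ h).2), hf.2.2 e⟩
  let r : ι × ι → (E → E → ℤ) →ₗ[ℤ] (E → E → ℤ) := fun p =>
    { toFun := fun f e e' => if e ∈ X p.1 ∧ e' ∈ X p.2 then f e e' else 0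
      map_add' := fun f g => by
        funext e e'; by_cases h : e ∈ X p.1 ∧ e' ∈ X p.2 <;> simp [h]
      map_smul' := fun c f => by
        funext e e'; by_cases h : e ∈ X p.1 ∧ e' ∈ X p.2 <;> simp [h] }
  have hr : ∀ p f e e', r p f e e' = if e ∈ X p.1 ∧ e' ∈ X p.2 then f e e' else 0 :=
    fun p f e e' => rfl
  have hmem : ∀ p, ∀ f ∈ biclosedOn d P, r p f ∈ biclosedOn d (P ∩ X p.1 ×ˢ X p.2) := by
    intro p f hf
    refine ⟨fun e e' h => ?_, fun e' t => ?_, fun e t => ?_⟩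
    · rw [hr]
      split_ifs with h'
      · exact hf.1 e e' fun h'' => h ⟨h'', h'⟩
      · rfl
    · by_cases he' : e' ∈ X p.2
      · have := (hres p.1 _ (hcol f hf e')).2 t
        simpa [hr, he', Set.indicator_apply] using this
      · simp [hr, he']
    · by_cases he : e ∈ X p.1
      · have := (hres p.2 _ (hrow f hf e)).2 t
        simpa [hr, he, Set.indicator_apply] using this
      · simp [hr, he]
  let Θ : biclosedOn d P →ₗ[ℤ] ∀ p : ι × ι, biclosedOn d (P ∩ X p.1 ×ˢ X p.2) :=
    LinearMap.pi fun p => (r p ∘ₗ (biclosedOn d P).subtype).codRestrict _ fun f => hmem p f f.2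
  have hΘ : ∀ f p, (Θ f p).1 = r p f.1 := fun f p => rfl
  have hbij : Function.Bijective Θ := by
    constructor
    · rw [← LinearMap.ker_eq_bot, LinearMap.ker_eq_bot']
      intro f hf
      refine Subtype.ext <| funext fun e => funext fun e' => ?_
      by_cases h : (e, e') ∈ P
      · obtain ⟨⟨i, hi⟩, j, hj⟩ := hP _ h
        have h1 : (Θ f (i, j)).1 e e' = 0 := by rw [hf]; rfl
        rw [hΘ, hr, if_pos ⟨hi, hj⟩] at h1
        exact h1
      · exact f.2.1 e e' h
    · intro g
      have hg : ∀ p, (g p).1 ∈ biclosedOn d P := fun p =>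
        ⟨fun e e' h => (g p).2.1 e e' fun h' => h h'.1, (g p).2.2⟩
      -- The blocks have disjoint supports, so their sum restricts to each of them.
      refine ⟨∑ p, ⟨(g p).1, hg p⟩, funext fun q => Subtype.ext ?_⟩
      rw [hΘ]
      funext e e'
      have hs : (∑ p, ⟨(g p).1, hg p⟩ : biclosedOn d P).1 e e' = ∑ p, (g p).1 e e' := by
        simp
      rw [hr, hs]
      split_ifs with h
      · refine Finset.sum_eq_single q (fun p _ hpq => (g p).2.1 e e' fun h' => hpq ?_) (by simp)
        exact Prod.ext (hX _ _ _ h'.2.1 h.1) (hX _ _ _ h'.2.2 h.2)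
      · exact ((g q).2.1 e e' fun h' => h h'.2).symm
  rw [(LinearEquiv.ofBijective Θ hbij).finrank_eq, finrank_pi_fintype]

/-! ### Top-dimensional homology as cycles on a finite index type -/

/-- In the top dimension the Betti number is the rank of the group of cycles. -/
theorem betti_eq_finrank_cycles {S : Type*} (dim : S → ℕ) (bd : S → (S →₀ ℤ)) (X : Set S) (k : ℕ)
    (h : ∀ s ∈ X, dim s ≠ k + 1) : betti dim bd X k = finrank ℤ (cycles dim bd X k) := by
  have h0 : chains dim X (k + 1) = ⊥ := by
    rw [chains, ← Finsupp.supported_empty]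
    congr 1
    ext s
    simpa using h s
  have hb : (boundaries dim bd X k).submoduleOf (cycles dim bd X k) = ⊥ := by
    rw [boundaries, h0, Submodule.map_bot, Submodule.submoduleOf, Submodule.comap_bot,
      Submodule.ker_subtype]
  exact (Submodule.quotEquivOfEqBot _ hb).finrank_eq

/-- Cycles as functions on a finite type that parametrizes the cells. -/
theorem finrank_cycles_eq {S E : Type*} [Fintype E] (dim : S → ℕ) (bd : S → (S →₀ ℤ)) (X : Set S)
    (k : ℕ) (φ : E → S) (hφ : Function.Injective φ) (Y : Set E)
    (hY : {s | s ∈ X ∧ dim s = k} = φ '' Y) (W : Submodule ℤ (E → ℤ))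
    (hW : ∀ z, z ∈ W ↔ (∀ e, e ∉ Y → z e = 0) ∧ ∑ e, z e • bd (φ e) = 0) :
    finrank ℤ (cycles dim bd X k) = finrank ℤ W := by
  let L : (E → ℤ) →ₗ[ℤ] (S →₀ ℤ) :=
    Finsupp.lmapDomain ℤ ℤ φ ∘ₗ (Finsupp.linearEquivFunOnFinite ℤ ℤ E).symm.toLinearMap
  have hL : Function.Injective L :=
    (Finsupp.mapDomain_injective hφ).comp (LinearEquiv.injective _)
  have key : cycles dim bd X k = W.map L := by
    ext f
    rw [cycles, chains, hY, ← Finsupp.lmapDomain_supported, Submodule.mem_inf, LinearMap.mem_ker]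
    constructor
    · rintro ⟨⟨g, hg, rfl⟩, hf⟩
      refine ⟨g, (hW _).2 ⟨fun e he => ?_, ?_⟩, ?_⟩
      · exact Finsupp.notMem_support_iff.1 fun h => he (hg h)
      · rw [Finsupp.lmapDomain_apply, Finsupp.linearCombination_mapDomain,
          Finsupp.linearCombination_apply, Finsupp.sum_fintype _ _ (by simp)] at hf
        exact hf
      · change Finsupp.mapDomain φ ((Finsupp.linearEquivFunOnFinite ℤ ℤ E).symm g) = _
        congr 1
        exact (Finsupp.linearEquivFunOnFinite ℤ ℤ E).symm_apply_apply g
    · rintro ⟨z, hz, rfl⟩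
      obtain ⟨h1, h2⟩ := (hW z).1 hz
      refine ⟨⟨(Finsupp.linearEquivFunOnFinite ℤ ℤ E).symm z, fun e he => ?_, rfl⟩, ?_⟩
      · by_contra h
        exact Finsupp.mem_support_iff.1 he (h1 e h)
      · change Finsupp.linearCombination ℤ bd (Finsupp.mapDomain φ
          ((Finsupp.linearEquivFunOnFinite ℤ ℤ E).symm z)) = 0
        rw [Finsupp.linearCombination_mapDomain,
          Finsupp.linearCombination_apply, Finsupp.sum_fintype _ _ (by simp)]
        exact h2
  rw [key]
  exact (Submodule.equivMapOfInjective L hL W).finrank_eq.symm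

/-! ### Betti numbers in terms of the incidence matrix -/

/-- The incidence matrix of the edges `(a, b)` and the vertices of a graph. -/
def incidence {V : Type*} [DecidableEq V] (p : V × V) (x : V) : ℤ :=
  (if p.2 = x then 1 else 0) - (if p.1 = x then 1 else 0)

theorem incidence_eq_zero {V : Type*} [DecidableEq V] {p : V × V} {x : V} (h1 : p.1 ≠ x)
    (h2 : p.2 ≠ x) : incidence p x = 0 := by simp [incidence, h1, h2]

theorem sum_incidence {V : Type*} [Fintype V] [DecidableEq V] (p : V × V) :
    ∑ x, incidence p x = 0 := by simp [incidence]

/-- The edges of a graph, as pairs of vertices. -/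
def edgePairs {V : Type*} [LinearOrder V] {G : SimpleGraph V} (H : G.Subgraph) : Set (V × V) :=
  {p | p.1 < p.2 ∧ H.Adj p.1 p.2}

/-- The ordered pairs of disjoint edges of a graph. -/
def disjointEdgePairs {V : Type*} [LinearOrder V] {G : SimpleGraph V} (H : G.Subgraph) :
    Set ((V × V) × (V × V)) :=
  {p | p.1 ∈ edgePairs H ∧ p.2 ∈ edgePairs H ∧
    Disjoint ({p.1.1, p.1.2} : Set V) {p.2.1, p.2.2}}

theorem edge_injective {V : Type*} :
    Function.Injective fun p : V × V => Cell.edge p.1 p.2 := by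
  rintro ⟨a, b⟩ ⟨c, d⟩ h
  simpa using h

theorem boundary_edge_apply {V : Type*} [DecidableEq V] (p : V × V) (x : V) :
    (Cell.edge p.1 p.2).boundary (.vertex x) = incidence p x := by
  by_cases h1 : p.1 = x <;> by_cases h2 : p.2 = x <;>
    simp [Cell.boundary, incidence, h1, h2, Finsupp.single_eq_of_ne']

theorem graphBetti_one {V : Type*} [Fintype V] [LinearOrder V] {G : SimpleGraph V}
    (H : G.Subgraph) : graphBetti H 1 = finrank ℤ (closedOn incidence (edgePairs H)) := by
  rw [graphBetti, betti_eq_finrank_cycles]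
  · refine finrank_cycles_eq _ _ _ _ _ edge_injective (edgePairs H) ?_ _ fun z => ?_
    · ext (x | ⟨a, b⟩)
      · simp [graphCells, Cell.dim]
      · simp [graphCells, Cell.dim, IsCell, edgePairs]
    · rw [mem_closedOn]
      refine and_congr_right fun _ => ?_
      rw [Finsupp.ext_iff]
      constructor
      · rintro h (x | ⟨a, b⟩)
        · rw [Finsupp.finsetSum_apply]
          simpa [boundary_edge_apply] using h x
        · rw [Finsupp.finsetSum_apply]
          simp [Cell.boundary]
      · intro h x
        have := h (.vertex x)
        rw [Finsupp.finsetSum_apply] at this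
        simpa [boundary_edge_apply] using this
  · rintro (x | ⟨a, b⟩) _ <;> simp [Cell.dim]

theorem pairBoundary_edge {V : Type*} (p q : V × V) :
    pairBoundary (Cell.edge p.1 p.2, Cell.edge q.1 q.2) =
      (Finsupp.single (.vertex p.2, .edge q.1 q.2) 1 -
        Finsupp.single (.vertex p.1, .edge q.1 q.2) 1) -
      (Finsupp.single (.edge p.1 p.2, .vertex q.2) 1 -
        Finsupp.single (.edge p.1 p.2, .vertex q.1) 1) := by
  have hsub : ∀ (f : Cell V → Cell V × Cell V) (x y : Cell V →₀ ℤ),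
      (x - y).mapDomain f = x.mapDomain f - y.mapDomain f := fun f x y =>
    map_sub (Finsupp.lmapDomain ℤ ℤ f) x y
  simp only [pairBoundary, Cell.boundary, Cell.dim, hsub, Finsupp.mapDomain_single, pow_one,
    neg_smul, one_smul]
  abel

theorem pairBoundary_edge_apply_left {V : Type*} [DecidableEq V] (p q q' : V × V) (x : V) :
    pairBoundary (Cell.edge p.1 p.2, Cell.edge q.1 q.2) (.vertex x, .edge q'.1 q'.2) =
      if q = q' then incidence p x else 0 := by
  rw [pairBoundary_edge]
  by_cases hq : q = q'
  · subst hq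
    by_cases h1 : p.1 = x <;> by_cases h2 : p.2 = x <;>
      simp [incidence, h1, h2, Finsupp.single_eq_of_ne']
  · have : ¬ (q.1 = q'.1 ∧ q.2 = q'.2) := fun h => hq (Prod.ext h.1 h.2)
    simp [hq, this, Finsupp.single_eq_of_ne']

theorem pairBoundary_edge_apply_right {V : Type*} [DecidableEq V] (p p' q : V × V) (x : V) :
    pairBoundary (Cell.edge p.1 p.2, Cell.edge q.1 q.2) (.edge p'.1 p'.2, .vertex x) =
      if p = p' then -incidence q x else 0 := by
  rw [pairBoundary_edge]
  by_cases hp : p = p'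
  · subst hp
    by_cases h1 : q.1 = x <;> by_cases h2 : q.2 = x <;>
      simp [incidence, h1, h2, Finsupp.single_eq_of_ne']
  · have : ¬ (p.1 = p'.1 ∧ p.2 = p'.2) := fun h => hp (Prod.ext h.1 h.2)
    simp [hp, this, Finsupp.single_eq_of_ne']

/-- The two halves of the boundary of a 2-cell lie in vertex × edge and edge × vertex cells, so they
cannot cancel. The coefficients at the former say that columns are cycles, those at the latter that
rows are. -/
theorem confBetti_two {V : Type*} [Fintype V] [LinearOrder V] {G : SimpleGraph V}
    (H : G.Subgraph) :
    confBetti H 2 = finrank ℤ (biclosedOn incidence (disjointEdgePairs H)) := by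
  rw [confBetti, betti_eq_finrank_cycles]
  · refine (finrank_cycles_eq (E := (V × V) × (V × V)) _ _ _ _
      (fun p => (Cell.edge p.1.1 p.1.2, Cell.edge p.2.1 p.2.2)) ?_ (disjointEdgePairs H) ?_
      ((biclosedOn incidence (disjointEdgePairs H)).map
        (LinearEquiv.curry ℤ ℤ (V × V) (V × V)).symm.toLinearMap) ?_).trans
      (LinearEquiv.finrank_map_eq (LinearEquiv.curry ℤ ℤ (V × V) (V × V)).symm _)
    · rintro ⟨p, q⟩ ⟨p', q'⟩ h
      simp only [Prod.mk.injEq] at h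
      exact Prod.ext (edge_injective h.1) (edge_injective h.2)
    · ext ⟨x | ⟨a, b⟩, y | ⟨c, d⟩⟩ <;>
        simp [confCells, pairDim, Cell.dim, IsCell, disjointEdgePairs, edgePairs, Cell.ends]
    · intro z
      rw [Submodule.mem_map_equiv, LinearEquiv.symm_symm, mem_biclosedOn]
      change ((∀ e e', (e, e') ∉ _ → z (e, e') = 0) ∧ (∀ e' t, ∑ e, z (e, e') * _ = 0) ∧
        ∀ e t, ∑ e', z (e, e') * _ = 0) ↔ _
      refine and_congr ⟨fun h e => h e.1 e.2, fun h e e' => h (e, e')⟩ ?_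
      have hV : ∀ x (q : V × V), (∑ e : (V × V) × (V × V), z e • pairBoundary
          (Cell.edge e.1.1 e.1.2, Cell.edge e.2.1 e.2.2)) (.vertex x, .edge q.1 q.2) =
          ∑ p, z (p, q) * incidence p x := by
        intro x q
        rw [Finsupp.finsetSum_apply, Fintype.sum_prod_type]
        simp [pairBoundary_edge_apply_left]
      have hE : ∀ x (p : V × V), (∑ e : (V × V) × (V × V), z e • pairBoundary
          (Cell.edge e.1.1 e.1.2, Cell.edge e.2.1 e.2.2)) (.edge p.1 p.2, .vertex x) =
          - ∑ q, z (p, q) * incidence q x := by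
        intro x p
        rw [Finsupp.finsetSum_apply, Fintype.sum_prod_type_right]
        simp [pairBoundary_edge_apply_right]
      constructor
      · rintro ⟨h1, h2⟩
        ext ⟨x | ⟨a, b⟩, y | ⟨c, d⟩⟩
        · rw [Finsupp.finsetSum_apply]
          simp [pairBoundary_edge]
        · exact (hV x (c, d)).trans (h1 (c, d) x)
        · exact (hE y (a, b)).trans (by rw [h2 (a, b) y, neg_zero]; rfl)
        · rw [Finsupp.finsetSum_apply]
          simp [pairBoundary_edge]
      · intro h
        refine ⟨fun q x => ?_, fun p x => ?_⟩
        · rw [← hV, h]; rfl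
        · rw [← neg_eq_zero, ← hE, h]; rfl
  · rintro ⟨x | ⟨a, b⟩, y | ⟨c, d⟩⟩ _ <;> simp [pairDim, Cell.dim]

/-! ### Detaching the cut vertex -/

/-- The edges of a graph at `v`. -/
def pairsAt {V : Type*} (v : V) : Set (V × V) := {p | p.1 = v ∨ p.2 = v}

/-- Each half-edge left by a subdivided edge ends in a leaf and so carries no cycle; what remains
are the edges not at `v`. -/
theorem graphBetti_detach_one {V : Type*} [Fintype V] [LinearOrder V] {G : SimpleGraph V} (v : V)
    (H : G.Subgraph) :
    graphBetti (detach v H) 1 = finrank ℤ (closedOn incidence (edgePairs H \ pairsAt v)) := by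
  rw [graphBetti_one]
  let ψ : V × V → (V ⊕ₗ V) × (V ⊕ₗ V) := fun p => (Sum.inlₗ p.1, Sum.inlₗ p.2)
  have hψ : Function.Injective ψ := by
    rintro ⟨a, b⟩ ⟨c, d⟩ h
    simpa [ψ] using h
  have hinl : ∀ p x, incidence (ψ p) (Sum.inlₗ x) = incidence p x := by
    intro p x
    simp [incidence, ψ]
  have hinr : ∀ p x, incidence (ψ p) (Sum.inrₗ x) = 0 := by
    intro p x
    simp [incidence, ψ]
  have hedge : ∀ p, ψ p ∈ edgePairs (detach v H) ↔ p ∈ edgePairs H \ pairsAt v := by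
    rintro ⟨a, b⟩
    simp [ψ, edgePairs, detach, pairsAt, and_assoc, Sum.inlₗ]
  have hoff : ∀ z ∈ closedOn incidence (edgePairs (detach v H)), ∀ p, p ∉ Set.range ψ →
      z p = 0 := by
    intro z hz p hp
    by_contra hzp
    have hpe : p ∈ edgePairs (detach v H) := by
      by_contra h
      exact hzp (hz.1 p h)
    obtain ⟨x, y⟩ := p
    -- The new vertex over `u` is a leaf. Its only edge is oriented as written because old vertices
    -- precede new ones in the lexicographic order.
    have hin : ∀ q : (V ⊕ₗ V) × (V ⊕ₗ V), q ∈ edgePairs (detach v H) → ∀ u,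
        (q.1 = Sum.inrₗ u ∨ q.2 = Sum.inrₗ u) → q = (Sum.inlₗ u, Sum.inrₗ u) := by
      rintro ⟨x, y⟩ ⟨hlt, hadj⟩ u hu
      induction x using Lex.rec with | _ x
      induction y using Lex.rec with | _ y
      rcases x with a | a <;> rcases y with b | b <;>
        simp_all [detach, Sum.inlₗ, Sum.inrₗ]
    have hu : ∃ u, (x, y) = (Sum.inlₗ u, Sum.inrₗ u) := by
      induction x using Lex.rec with | _ x
      induction y using Lex.rec with | _ y
      rcases x with a | a
      · rcases y with b | b
        · exact absurd ⟨(a, b), rfl⟩ hp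
        · exact ⟨b, hin _ hpe b (.inr rfl)⟩
      · exact ⟨a, hin _ hpe a (.inl rfl)⟩
    obtain ⟨u, hu⟩ := hu
    -- The cycle equation at a leaf has a single term, which forces the coefficient of its edge to
    -- vanish.
    have h := hz.2 (Sum.inrₗ u)
    rw [Fintype.sum_eq_single (x, y)] at h
    · obtain ⟨rfl, rfl⟩ := Prod.mk.inj hu
      exact hzp (by simpa [incidence] using h)
    · intro q hq
      by_cases hqe : q ∈ edgePairs (detach v H)
      · rw [incidence_eq_zero, mul_zero]
        · exact fun h' => hq ((hin q hqe u (.inl h')).trans hu.symm)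
        · exact fun h' => hq ((hin q hqe u (.inr h')).trans hu.symm)
      · rw [hz.1 q hqe, zero_mul]
  let L : ((V ⊕ₗ V) × (V ⊕ₗ V) → ℤ) →ₗ[ℤ] (V × V → ℤ) := LinearMap.funLeft ℤ ℤ ψ
  have hL : ∀ z p, L z p = z (ψ p) := fun z p => rfl
  have hmem : ∀ z ∈ closedOn incidence (edgePairs (detach v H)),
      L z ∈ closedOn incidence (edgePairs H \ pairsAt v) := by
    intro z hz
    refine ⟨fun p hp => hz.1 _ fun h => hp ((hedge p).1 h), fun x => ?_⟩
    rw [← hz.2 (Sum.inlₗ x)]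
    refine Fintype.sum_of_injective ψ hψ _ _ (fun q hq => ?_) fun p => ?_
    · rw [hoff z hz q hq, zero_mul]
    · rw [hL, hinl]
  refine (LinearEquiv.ofBijective (L.restrict hmem) ⟨?_, ?_⟩).finrank_eq
  · rw [← LinearMap.ker_eq_bot, LinearMap.ker_eq_bot']
    intro z hz
    refine Subtype.ext <| funext fun q => ?_
    by_cases hq : q ∈ Set.range ψ
    · obtain ⟨p, rfl⟩ := hq
      exact congrFun (congrArg Subtype.val hz) p
    · exact hoff z z.2 q hq
  · intro w
    -- Conversely, extend a cycle by zero over the half-edges.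
    have hext : ∀ p, Function.extend ψ w.1 0 (ψ p) = w.1 p := fun p => hψ.extend_apply _ _ _
    have hext' : ∀ q, q ∉ Set.range ψ → Function.extend ψ w.1 0 q = 0 := fun q hq =>
      Function.extend_apply' _ _ _ hq
    refine ⟨⟨Function.extend ψ w.1 0, fun q hq => ?_, fun x => ?_⟩, ?_⟩
    · by_cases h : q ∈ Set.range ψ
      · obtain ⟨p, rfl⟩ := h
        rw [hext]
        exact w.2.1 p fun h => hq ((hedge p).2 h)
      · exact hext' q h
    · have : ∑ q, Function.extend ψ w.1 0 q * incidence q x =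
          ∑ p, w.1 p * incidence (ψ p) x := by
        refine (Fintype.sum_of_injective ψ hψ _ _ (fun q hq => ?_) fun p => ?_).symm
        · rw [hext' q hq, zero_mul]
        · rw [hext]
      rw [this]
      induction x using Lex.rec with | _ x
      rcases x with x | x
      · rw [← w.2.2 x]
        exact Finset.sum_congr rfl fun p _ => by rw [← hinl p x]
      · exact Finset.sum_eq_zero fun p _ => by
          rw [show incidence (ψ p) (toLex (Sum.inr x)) = 0 from hinr p x, mul_zero]
    · exact Subtype.ext <| funext hext

/-- Disjointness of two edges does not depend on the ambient graph, so a diagonal block is the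
configuration space of the component itself. -/
theorem disjointEdgePairs_top_inter {V : Type*} [LinearOrder V] {G : SimpleGraph V}
    (H : G.Subgraph) :
    disjointEdgePairs (⊤ : G.Subgraph) ∩ edgePairs H ×ˢ edgePairs H = disjointEdgePairs H := by
  ext ⟨p, q⟩
  constructor
  · rintro ⟨⟨_, _, hd⟩, hp, hq⟩
    exact ⟨hp, hq, hd⟩
  · rintro ⟨hp, hq, hd⟩
    exact ⟨⟨⟨hp.1, hp.2.adj_sub⟩, ⟨hq.1, hq.2.adj_sub⟩, hd⟩, hp, hq⟩

/-! ### Wedge sums -/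

section Wedge

variable {V ι : Type*} {G : SimpleGraph V} {v : V}
  {H : ι → G.Subgraph}

theorem IsWedge.eq_of_mem (h : IsWedge G v H) {i j : ι} {x : V} (hi : x ∈ (H i).verts)
    (hj : x ∈ (H j).verts) (hx : x ≠ v) : i = j := by
  by_contra hij
  have : x ∈ (H i).verts ∩ (H j).verts := ⟨hi, hj⟩
  rw [h.inter_eq i j hij] at this
  exact hx this

variable [LinearOrder V]

/-- An edge has an end other than `v`, and that end determines the component. -/
theorem IsWedge.eq_of_mem_edgePairs (h : IsWedge G v H) {i j : ι} {p : V × V}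
    (hi : p ∈ edgePairs (H i)) (hj : p ∈ edgePairs (H j)) : i = j := by
  by_cases hp : p.1 = v
  · exact h.eq_of_mem hi.2.snd_mem hj.2.snd_mem fun h' => hi.1.ne (hp.trans h'.symm)
  · exact h.eq_of_mem hi.2.fst_mem hj.2.fst_mem hp

theorem IsWedge.exists_mem_edgePairs (h : IsWedge G v H) {p : V × V}
    (hp : p ∈ edgePairs (⊤ : G.Subgraph)) : ∃ i, p ∈ edgePairs (H i) := by
  have := hp.2
  rw [← h.iSup_eq, SimpleGraph.Subgraph.iSup_adj] at this
  obtain ⟨i, hi⟩ := this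
  exact ⟨i, hp.1, hi⟩

/-- At a vertex of the component other than `v`, all edges of the wedge belong to that component, so
the cycle equation survives restriction. The equation at `v` then follows, since each edge has total
incidence zero and hence the boundary coefficients sum to zero. -/
theorem IsWedge.indicator_mem_closedOn [Fintype V] (h : IsWedge G v H) (i : ι) {z : V × V → ℤ}
    (hz : z ∈ closedOn incidence (⋃ i, edgePairs (H i))) :
    (edgePairs (H i)).indicator z ∈ closedOn incidence (edgePairs (H i)) := by
  classical
  have hne : ∀ x, x ≠ v →
      ∑ p, (edgePairs (H i)).indicator z p * incidence p x = 0 := by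
    intro x hx
    by_cases hxi : x ∈ (H i).verts
    · rw [← hz.2 x]
      refine Finset.sum_congr rfl fun p _ => ?_
      by_cases hp : p ∈ edgePairs (H i)
      · rw [Set.indicator_of_mem hp]
      · rw [Set.indicator_of_notMem hp, zero_mul]
        by_cases hp' : p ∈ ⋃ i, edgePairs (H i)
        · obtain ⟨j, hj⟩ := Set.mem_iUnion.1 hp'
          rw [incidence_eq_zero, mul_zero]
          · rintro rfl
            exact hp (h.eq_of_mem hxi hj.2.fst_mem hx ▸ hj)
          · rintro rfl
            exact hp (h.eq_of_mem hxi hj.2.snd_mem hx ▸ hj)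
        · rw [hz.1 p hp', zero_mul]
    · refine Finset.sum_eq_zero fun p _ => ?_
      by_cases hp : p ∈ edgePairs (H i)
      · rw [incidence_eq_zero, mul_zero]
        · rintro rfl
          exact hxi hp.2.fst_mem
        · rintro rfl
          exact hxi hp.2.snd_mem
      · rw [Set.indicator_of_notMem hp, zero_mul]
  refine ⟨fun p hp => Set.indicator_of_notMem hp z, fun x => ?_⟩
  by_cases hx : x = v
  · have htot : ∑ x, ∑ p, (edgePairs (H i)).indicator z p * incidence p x = 0 := by
      rw [Finset.sum_comm]
      exact Finset.sum_eq_zero fun p _ => by rw [← Finset.mul_sum, sum_incidence, mul_zero]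
    rw [Fintype.sum_eq_single v hne] at htot
    rw [hx, htot]
  · exact hne x hx

/-- Edges of different components can share only `v`, and they do so exactly when both are at `v`.
-/
theorem IsWedge.disjointEdgePairs_inter (h : IsWedge G v H) {i j : ι} (hij : i ≠ j) :
    disjointEdgePairs (⊤ : G.Subgraph) ∩ edgePairs (H i) ×ˢ edgePairs (H j) =
      (edgePairs (H i) ×ˢ edgePairs (H j)) \ (pairsAt v ×ˢ pairsAt v) := by
  ext ⟨p, q⟩
  constructor
  · rintro ⟨⟨_, _, hd⟩, hpq⟩
    exact ⟨hpq, fun ⟨hp, hq⟩ => Set.disjoint_left.1 hd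
      (show v ∈ ({p.1, p.2} : Set V) from hp.imp Eq.symm Eq.symm) (hq.imp Eq.symm Eq.symm)⟩
  · rintro ⟨⟨hp, hq⟩, hv⟩
    refine ⟨⟨⟨hp.1, hp.2.adj_sub⟩, ⟨hq.1, hq.2.adj_sub⟩, ?_⟩, hp, hq⟩
    refine Set.disjoint_left.2 fun x hx hx' => hv ?_
    have hxi : x ∈ (H i).verts := by
      rcases hx with rfl | rfl
      exacts [hp.2.fst_mem, hp.2.snd_mem]
    have hxj : x ∈ (H j).verts := by
      rcases hx' with rfl | rfl
      exacts [hq.2.fst_mem, hq.2.snd_mem]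
    have hxv : x = v := by
      by_contra hne
      exact hij (h.eq_of_mem hxi hxj hne)
    subst hxv
    exact ⟨hx.imp Eq.symm Eq.symm, hx'.imp Eq.symm Eq.symm⟩

/-- The second Betti number of the two-particle configuration space of a wedge sum. -/
theorem IsWedge.confBetti_two_eq [Fintype V] [Fintype ι] [LinearOrder ι] (h : IsWedge G v H) :
    (confBetti (⊤ : G.Subgraph) 2 : ℤ) = (∑ i, (confBetti (H i) 2 : ℤ)) +
      2 * ∑ p : ι × ι with p.1 < p.2, ((graphBetti (H p.1) 1 : ℤ) * graphBetti (H p.2) 1 -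
        lostCycles v (H p.1) * lostCycles v (H p.2)) := by
  let F : ι × ι → ℤ := fun p =>
    (graphBetti (H p.1) 1 : ℤ) * graphBetti (H p.2) 1 -
        lostCycles v (H p.1) * lostCycles v (H p.2)
  let B : ι × ι → ℤ := fun p => (finrank ℤ (biclosedOn incidence
    (disjointEdgePairs (⊤ : G.Subgraph) ∩ edgePairs (H p.1) ×ˢ edgePairs (H p.2))) : ℕ)
  have hB : ∀ p : ι × ι, p.1 ≠ p.2 → B p = F p := by
    intro p hp
    simp only [B, F]
    rw [h.disjointEdgePairs_inter hp, finrank_biclosedOn_prod_diff, lostCycles, lostCycles,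
      graphBetti_one, graphBetti_one, graphBetti_detach_one, graphBetti_detach_one]
  have hdiag : ∀ i, B (i, i) = confBetti (H i) 2 := by
    intro i
    simp only [B]
    rw [disjointEdgePairs_top_inter, confBetti_two]
  have htop : (confBetti (⊤ : G.Subgraph) 2 : ℤ) = ∑ p, B p := by
    rw [confBetti_two, finrank_biclosedOn_eq_sum incidence (fun i => edgePairs (H i))
      (fun i j e => h.eq_of_mem_edgePairs) (disjointEdgePairs ⊤)
      (fun p hp => ⟨h.exists_mem_edgePairs hp.1, h.exists_mem_edgePairs hp.2.1⟩)
      (fun i z hz => h.indicator_mem_closedOn i hz), Nat.cast_sum]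
  have hsplit : ∑ p, B p = ∑ p : ι × ι with p.1 = p.2, B p +
      (∑ p : ι × ι with p.1 < p.2, B p + ∑ p : ι × ι with p.2 < p.1, B p) := by
    rw [Finset.sum_filter, Finset.sum_filter, Finset.sum_filter, ← Finset.sum_add_distrib,
      ← Finset.sum_add_distrib]
    refine Finset.sum_congr rfl fun p _ => ?_
    rcases lt_trichotomy p.1 p.2 with h | h | h
    · simp [h, h.ne, h.not_gt]
    · simp [h]
    · simp [h, h.ne', h.not_gt]
  have h1 : ∑ p : ι × ι with p.1 = p.2, B p = ∑ i, (confBetti (H i) 2 : ℤ) := by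
    rw [Finset.sum_filter, Fintype.sum_prod_type]
    simp [hdiag]
  have h2 : ∑ p : ι × ι with p.1 < p.2, B p = ∑ p : ι × ι with p.1 < p.2, F p :=
    Finset.sum_congr rfl fun p hp => hB p (Finset.mem_filter.1 hp).2.ne
  -- The block contribution is symmetric in the two components, whence the factor 2.
  have h3 : ∑ p : ι × ι with p.2 < p.1, B p = ∑ p : ι × ι with p.1 < p.2, F p := by
    refine Finset.sum_equiv (Equiv.prodComm ι ι) (by simp) fun p hp => ?_
    rw [hB p (Finset.mem_filter.1 hp).2.ne']
    simp only [F, Equiv.prodComm_apply, Prod.fst_swap, Prod.snd_swap]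
    ring
  rw [htop, hsplit, h1, h2, h3, two_mul]

end Wedge

end GraphConf

theorem mainTheorem5 {V : Type*} [Fintype V] [LinearOrder V] (G : SimpleGraph V) (v : V)
    (hG : GraphConf.IsOneConnectedAt G v) :
    (∀ H : Fin 2 → G.Subgraph, GraphConf.IsWedge G v H →
      (GraphConf.confBetti (⊤ : G.Subgraph) 2 : ℤ) =
        GraphConf.confBetti (H 0) 2 + GraphConf.confBetti (H 1) 2 +
          2 * ((GraphConf.graphBetti (GraphConf.detach v (H 0)) 1 : ℤ) *
                GraphConf.graphBetti (H 1) 1 +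
              (GraphConf.graphBetti (H 0) 1 : ℤ) *
                GraphConf.graphBetti (GraphConf.detach v (H 1)) 1 -
              (GraphConf.graphBetti (GraphConf.detach v (H 0)) 1 : ℤ) *
                GraphConf.graphBetti (GraphConf.detach v (H 1)) 1)) ∧
    (∀ (m : ℕ) (H : Fin m → G.Subgraph), GraphConf.IsWedge G v H →
      (GraphConf.confBetti (⊤ : G.Subgraph) 2 : ℤ) =
        (∑ i, (GraphConf.confBetti (H i) 2 : ℤ)) +
          2 * ∑ p : Fin m × Fin m with p.1 < p.2,
            ((GraphConf.graphBetti (H p.1) 1 : ℤ) * GraphConf.graphBetti (H p.2) 1 -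
              GraphConf.lostCycles v (H p.1) * GraphConf.lostCycles v (H p.2))) := by
  refine ⟨fun H h => ?_, fun m H h => h.confBetti_two_eq⟩
  -- Part (i) is the case of a single pair: `a b - (a - a') (b - b') = a' b + a b' - a' b'`.
  have hfilter : (Finset.univ.filter fun p : Fin 2 × Fin 2 => p.1 < p.2) = {(0, 1)} := by decide
  rw [h.confBetti_two_eq, hfilter, Finset.sum_singleton, Fin.sum_univ_two]
  simp only [GraphConf.lostCycles]
  ring
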